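/- Let $\mathcal A$ be a Grothendieck abelian category that is locally noetherian, i.e. has a generating set of noetherian objects (an object is noetherian if every ascending chain of its subobjects stabilises). Let $\Gamma$ be the category of finite sets and all maps between them. Then the functor category $\operatorname{Fun}(\Gamma^{\mathrm{op}},\mathcal A)$ (functors $\Gamma^{\mathrm{op}}\to\mathcal A$ and natural transformations) is a locally noetherian Grothendieck abelian category. -/

import Mathlib

open CategoryTheory

universe w v u t

/-- A Grothendieck abelian category (relative to the universe `w` of small sets) is
*locally noetherian* if it has a (small) generating set of noetherian objects. The Grothendieck
axioms are part of the definition. -/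
class IsLocallyNoetherianGrothendieck (C : Type u) [Category.{v} C] [Abelian C] : Prop where
  isGrothendieckAbelian : IsGrothendieckAbelian.{w} C
  exists_generators : ∃ P : ObjectProperty C,
    ObjectProperty.Small.{w} P ∧ (∀ X : C, P X → IsNoetherianObject X) ∧ P.IsSeparating

/-! This is a Gröbner basis argument. Free functors on noetherian objects generate, so it suffices
that each is noetherian. On `Γᵒᵖ`, the free functor at `X` has as basis the words over the alphabet
`X`. Ordering words of equal length lexicographically, a subfunctor gets at each word an object of
leading coefficients in `M`. Nested subfunctors with the same leading coefficients coincide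
(division algorithm), and leading coefficients grow along ordered surjections, which preserve the
lexicographic order. By Higman's lemma these surjections well-quasi-order the words, so a
non-stabilising chain of subfunctors would give one in `M`. -/

/-- A family of monotone maps from a well-quasi-order to a noetherian poset which depends
monotonically and faithfully on a parameter forces the parameter poset to be noetherian. -/
theorem wellFoundedGT_of_wellQuasiOrdered {S W P : Type*} [PartialOrder S] [PartialOrder P]
    [WellFoundedGT P] {r : W → W → Prop} [IsPreorder W r] (hr : WellQuasiOrdered r)
    (L : S → W → P) (hL : Monotone L) (hLr : ∀ s {a b}, r a b → L s a ≤ L s b)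
    (hinj : ∀ {s s'}, s ≤ s' → L s = L s' → s = s') : WellFoundedGT S := by
  rw [wellFoundedGT_iff_monotone_chain_condition]
  by_contra! H
  obtain ⟨f, hf⟩ := H
  have key : ∀ n, ∃ m, n < m ∧ ∃ a, L (f n) a < L (f m) a := by
    intro n
    obtain ⟨m, hnm, hne⟩ := hf n
    refine ⟨m, lt_of_le_of_ne hnm (by rintro rfl; exact hne rfl), ?_⟩
    by_contra! h
    refine hne (hinj (f.monotone hnm) (funext fun a => ?_))
    exact eq_of_le_of_not_lt (hL (f.monotone hnm) a) (h a)
  choose next hnext a ha using key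
  let k : ℕ → ℕ := fun n => next^[n] 0
  have hk (n : ℕ) : k (n + 1) = next (k n) := Function.iterate_succ_apply' next n 0
  have hkmono : StrictMono k := strictMono_nat_of_lt_succ fun n => by
    rw [hk]; exact hnext _
  obtain ⟨g, hg⟩ := hr.exists_monotone_subseq fun n => a (k n)
  -- Each step is strict at the witness `a (k (g n))`, and the witnesses increase along `r`, so the
  -- values climb strictly in `P`.
  refine not_strictMono_of_wellFoundedGT (fun n => L (f (k (g n))) (a (k (g n))))
    (strictMono_nat_of_lt_succ fun n => ?_)
  refine (ha (k (g n))).trans_le ?_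
  rw [← hk]
  refine (hL (f.monotone (hkmono.monotone ?_)) _).trans (hLr _ (hg _ _ n.le_succ))
  exact g.strictMono n.lt_succ_self

/-! ### Words and ordered surjections -/

/-- A map of finite ordinals is an ordered surjection if it is surjective and the smallest
elements of its fibres appear in increasing order. -/
structure IsOrderedSurjection {m n : ℕ} (f : Fin m → Fin n) : Prop where
  surjective : Function.Surjective f
  exists_lt : ∀ i j, i < f j → ∃ k < j, f k = i

/-- Precomposition with an ordered surjection strictly preserves the lexicographic order. -/
theorem IsOrderedSurjection.toLex_comp_lt {α : Type*} [LinearOrder α] {m n : ℕ}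
    {f : Fin m → Fin n} (hf : IsOrderedSurjection f) {u v : Fin n → α}
    (h : toLex u < toLex v) : toLex (u ∘ f) < toLex (v ∘ f) := by
  obtain ⟨i, hi, hlt⟩ := h
  have hex : ∃ j, f j = i := hf.surjective i
  -- The pulled-back words first differ at the first `j` over `i`: earlier positions lie over
  -- indices below `i`.
  obtain ⟨j, hj, hmin⟩ := WellFounded.has_min (wellFounded_lt (α := Fin m)) {j | f j = i} hex
  refine ⟨j, fun k hk => hi (f k) ?_, ?_⟩
  · by_contra! hle
    rcases hle.lt_or_eq with hlt' | heq
    · obtain ⟨l, hl, rfl⟩ := hf.exists_lt _ _ hlt'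
      exact hmin l rfl (hl.trans hk)
    · exact hmin k heq.symm hk
  · change u (f j) < v (f j)
    rw [show f j = i from hj]
    exact hlt

/-- Words over a finite alphabet are well-quasi-ordered by pullback along ordered surjections. -/
theorem wellQuasiOrdered_orderedSurjection (α : Type*) [Finite α] :
    WellQuasiOrdered fun a b : Σ n, Fin n → α =>
      ∃ f : Fin b.1 → Fin a.1, IsOrderedSurjection f ∧ a.2 ∘ f = b.2 := by
  -- Higman's lemma, over a finite alphabet compared by equality.
  have hH : WellQuasiOrdered (List.SublistForall₂ (α := α × Set α) (· = ·)) := by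
    have := Set.PartiallyWellOrderedOn.partiallyWellOrderedOn_sublistForall₂
      (α := α × Set α) (· = ·) (s := Set.univ) (Set.toFinite _).partiallyWellOrderedOn
    intro f
    obtain ⟨m, n, hmn, h⟩ := this fun n => ⟨f n, fun _ _ => trivial⟩
    exact ⟨m, n, hmn, h⟩
  have hE : WellQuasiOrdered (α := Set α) (· = ·) := Finite.wellQuasiOrdered _
  -- Each letter records the letters seen so far, so that the embedding given by Higman's lemma
  -- extends to an ordered surjection.
  let seen (a : Σ n, Fin n → α) (i : Fin a.1) : Set α := {x | ∃ k ≤ i, a.2 k = x}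
  let code (a : Σ n, Fin n → α) : Set α × List (α × Set α) :=
    (Set.range a.2, List.ofFn fun i => (a.2 i, seen a i))
  intro s
  obtain ⟨m, n, hmn, h⟩ := (hE.prod hH) (code ∘ s)
  obtain ⟨hr, hs⟩ : (code (s m)).1 = (code (s n)).1 ∧
    (code (s m)).2.SublistForall₂ (· = ·) (code (s n)).2 := h
  refine ⟨m, n, hmn, ?_⟩
  generalize s m = a at hr hs
  generalize s n = b at hr hs
  obtain ⟨l, hl, hsub⟩ := List.sublistForall₂_iff.1 hs
  rw [List.forall₂_eq_eq_eq] at hl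
  subst hl
  obtain ⟨φ', hφ'⟩ := List.sublist_iff_exists_fin_orderEmbedding_get_eq.1 hsub
  obtain ⟨φ, hφ⟩ : ∃ φ : Fin a.1 → Fin b.1, StrictMono φ ∧
      ∀ i, a.2 i = b.2 (φ i) ∧ seen a i = seen b (φ i) := by
    refine ⟨fun i => Fin.cast (by simp [code]) (φ' (Fin.cast (by simp [code]) i)), ?_, ?_⟩
    · intro i j hij
      exact φ'.strictMono (show Fin.cast _ i < Fin.cast _ j from hij)
    · intro i
      have := hφ' (Fin.cast (by simp [code]) i)
      simp only [code, List.get_ofFn, Prod.mk.injEq] at this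
      exact this
  obtain ⟨hmono, hφ⟩ := hφ
  have hfirst (j : Fin b.1) : ∃ i, a.2 i = b.2 j ∧ ∀ k < i, a.2 k ≠ b.2 j := by
    have hj : b.2 j ∈ Set.range a.2 := by
      rw [show Set.range a.2 = Set.range b.2 from hr]; exact ⟨j, rfl⟩
    obtain ⟨i, hi, hmin⟩ := WellFounded.has_min (wellFounded_lt (α := Fin a.1)) _ hj
    exact ⟨i, hi, fun k hk h => hmin k h hk⟩
  choose first hfirst_eq hfirst_min using hfirst
  classical
  -- Invert `φ` on its image; elsewhere go to the first occurrence of the same letter in `a`.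
  let f (j : Fin b.1) : Fin a.1 := if h : ∃ i, φ i = j then h.choose else first j
  have hf_image (i : Fin a.1) : f (φ i) = i := by
    have h : ∃ i', φ i' = φ i := ⟨i, rfl⟩
    simp only [f, dif_pos h]
    exact hmono.injective h.choose_spec
  have hf_of_not {j : Fin b.1} (h : ¬ ∃ i, φ i = j) : f j = first j := dif_neg h
  refine ⟨f, ⟨fun i => ⟨φ i, hf_image i⟩, fun i j hij => ⟨φ i, ?_, hf_image i⟩⟩, ?_⟩
  · by_cases h : ∃ i', φ i' = j
    · obtain ⟨i', rfl⟩ := h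
      rw [hf_image] at hij
      exact hmono hij
    · rw [hf_of_not h] at hij
      -- Otherwise the letter at `j` is seen in `b` by `φ i`, hence in `a` by `i`, before its first
      -- occurrence.
      by_contra! hle
      have : b.2 j ∈ seen a i := by
        rw [(hφ i).2]; exact ⟨j, hle, rfl⟩
      obtain ⟨k, hk, hkj⟩ := this
      exact hfirst_min j k (hk.trans_lt hij) hkj
  · funext j
    by_cases h : ∃ i', φ i' = j
    · obtain ⟨i', rfl⟩ := h
      simp [hf_image, (hφ i').1]
    · simp [hf_of_not h, hfirst_eq]

/-! ### Free functors and their coordinates -/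

section FreeFunctor

open Limits Subobject

variable {C : Type*} [Category* C] {A : Type*} [Category* A] [Abelian A]

/-- A subobject of a quotient contains a generalized element as soon as it does so after
precomposition with an epimorphism. -/
theorem CategoryTheory.Subobject.factors_of_epi_comp {X T T' : A} (P : Subobject X) (x : T ⟶ X)
    (π : T' ⟶ T) [Epi π] (h : P.Factors (π ≫ x)) : P.Factors x := by
  have := strongEpi_of_epi π
  have sq : CommSq (P.factorThru _ h) π P.arrow x := ⟨by simp⟩
  exact (P.factors_iff x).2 ⟨sq.lift, sq.fac_right⟩

theorem exists_lift_of_imageSubobject_factors {X Y T : A} (f : X ⟶ Y) (x : T ⟶ Y)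
    (h : (imageSubobject f).Factors x) :
    ∃ (T' : A) (π : T' ⟶ T) (_ : Epi π) (z : T' ⟶ X), π ≫ x = z ≫ f := by
  obtain ⟨T', π, hπ, z, hz⟩ := surjective_up_to_refinements_of_epi
    (factorThruImageSubobject f) ((imageSubobject f).factorThru x h)
  refine ⟨T', π, hπ, z, ?_⟩
  have := hz =≫ (imageSubobject f).arrow
  rwa [Category.assoc, factorThru_arrow, Category.assoc, imageSubobject_arrow_comp] at this

variable [∀ X Y : C, Finite (X ⟶ Y)]

/-- The functor freely generated by the object `M` placed at `c`. -/
noncomputable abbrev freeFunctor (c : C) (M : A) : C ⥤ A :=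
  (evaluationLeftAdjoint A c).obj M

variable {c : C} {M : A}

/-- The inclusion into the free functor on `M` at `c` indexed by a morphism out of `c`. -/
noncomputable def freeι {Y : C} (g : c ⟶ Y) : M ⟶ (freeFunctor c M).obj Y :=
  Sigma.ι (fun _ : c ⟶ Y => M) g

theorem freeFunctor_hom_ext {Y : C} {T : A} {p q : (freeFunctor c M).obj Y ⟶ T}
    (h : ∀ g : c ⟶ Y, freeι g ≫ p = freeι g ≫ q) : p = q :=
  Sigma.hom_ext _ _ h

theorem freeι_map {Y Z : C} (g : c ⟶ Y) (f : Y ⟶ Z) :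
    freeι g ≫ (freeFunctor c M).map f = freeι (g ≫ f) :=
  Sigma.ι_desc _ g

open Classical in
/-- The coordinate of the free functor on `M` at `c` indexed by a morphism out of `c`. -/
noncomputable def coord {Y : C} (h : c ⟶ Y) : (freeFunctor c M).obj Y ⟶ M :=
  Sigma.desc fun g => if g = h then 𝟙 M else 0

open Classical in
theorem freeι_coord {Y : C} (g h : c ⟶ Y) :
    freeι g ≫ coord h = if g = h then 𝟙 M else 0 :=
  Sigma.ι_desc _ g

/-- Hom-sets are finite, so the coproduct is a biproduct and its identity is a sum over coordinates.
-/
theorem eq_zero_of_coord {Y : C} {T : A} (y : T ⟶ (freeFunctor c M).obj Y)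
    (hy : ∀ h : c ⟶ Y, y ≫ coord h = 0) : y = 0 := by
  classical
  have := Fintype.ofFinite (c ⟶ Y)
  have hid : 𝟙 ((freeFunctor c M).obj Y) = ∑ h : c ⟶ Y, coord h ≫ freeι h := by
    refine freeFunctor_hom_ext fun g => ?_
    rw [Preadditive.comp_sum]
    simp_rw [← Category.assoc, freeι_coord]
    rw [Finset.sum_eq_single g]
    · simp
    · intro b _ hb
      simp [hb.symm]
    · simp
  rw [← Category.comp_id y, hid, Preadditive.comp_sum]
  refine Finset.sum_eq_zero fun h _ => ?_
  rw [← Category.assoc, hy, zero_comp]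

/-- The `k`-th coordinate of an image is the sum of the coordinates over the fibre of `k`; here at
most the term at `h` survives. -/
theorem comp_map_comp_coord {Y Z : C} {T : A} (f : Y ⟶ Z) (y : T ⟶ (freeFunctor c M).obj Y)
    (h : c ⟶ Y) (k : c ⟶ Z) (hk : ∀ g : c ⟶ Y, g ≫ f = k → g ≠ h → y ≫ coord g = 0) :
    y ≫ (freeFunctor c M).map f ≫ coord k = open Classical in
      if h ≫ f = k then y ≫ coord h else 0 := by
  classical
  have := Fintype.ofFinite (c ⟶ Y)
  have hmap : (freeFunctor c M).map f ≫ coord k =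
      ∑ g : c ⟶ Y, if g ≫ f = k then coord g else 0 := by
    refine freeFunctor_hom_ext fun g => ?_
    rw [Preadditive.comp_sum, Finset.sum_eq_single g]
    · rw [← Category.assoc, freeι_map, freeι_coord]
      split_ifs <;> simp [freeι_coord]
    · intro b _ hb
      split_ifs
      · rw [freeι_coord, if_neg hb.symm]
      · simp
    · simp
  rw [hmap, Preadditive.comp_sum, Finset.sum_eq_single h]
  · split_ifs <;> simp
  · intro g _ hg
    split_ifs with h1
    · exact hk g h1 hg
    · simp
  · simp

/-! ### Leading coefficients -/

section Leading

variable {Y : C} [LinearOrder (c ⟶ Y)]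

/-- The `w`-th coordinates of the generalized elements of `N` at `Y` whose coordinates
beyond `w` vanish. -/
noncomputable def leadingSubobject (N : Subobject (freeFunctor c M)) (w : c ⟶ Y) : Subobject M :=
  imageSubobject (kernel.ι (N.arrow.app Y ≫ Pi.lift fun u : {u : c ⟶ Y // w < u} => coord u.1) ≫
    N.arrow.app Y ≫ coord w)

theorem leadingSubobject_factors_iff (N : Subobject (freeFunctor c M)) (w : c ⟶ Y) {T : A}
    (x : T ⟶ M) : (leadingSubobject N w).Factors x ↔
      ∃ (T' : A) (π : T' ⟶ T) (_ : Epi π) (z : T' ⟶ (N : C ⥤ A).obj Y),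
        (∀ u, w < u → z ≫ N.arrow.app Y ≫ coord u = 0) ∧
          π ≫ x = z ≫ N.arrow.app Y ≫ coord w := by
  constructor
  · intro h
    obtain ⟨T', π, hπ, z, hz⟩ := exists_lift_of_imageSubobject_factors _ x h
    refine ⟨T', π, hπ, z ≫ kernel.ι _, fun u hu => ?_, ?_⟩
    · have := kernel.condition (N.arrow.app Y ≫
        Pi.lift fun u : {u : c ⟶ Y // w < u} => coord (M := M) u.1) =≫ Pi.π _ ⟨u, hu⟩
      simp only [Category.assoc, Pi.lift_π, zero_comp] at this
      rw [Category.assoc, this, comp_zero]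
    · rw [hz, Category.assoc]
  · rintro ⟨T', π, _, z, hz, hx⟩
    refine factors_of_epi_comp _ x π ?_
    have hk : z ≫ N.arrow.app Y ≫ Pi.lift (fun u : {u : c ⟶ Y // w < u} => coord u.1) = 0 :=
      Pi.hom_ext _ _ fun u => by simpa using hz u.1 u.2
    rw [hx, ← kernel.lift_ι _ z hk, Category.assoc]
    exact imageSubobject_factors_comp_self _ _

theorem CategoryTheory.Subobject.le_of_forall_factors {A : Type*} [Category* A] {X : A}
    {P Q : Subobject X}
    (h : ∀ {T : A} (x : T ⟶ X), P.Factors x → Q.Factors x) : P ≤ Q := by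
  have hQ := h P.arrow (P.factors_self)
  exact le_of_comm (Q.factorThru _ hQ) (by simp)

theorem leadingSubobject_mono {N N' : Subobject (freeFunctor c M)} (h : N ≤ N') (w : c ⟶ Y) :
    leadingSubobject N w ≤ leadingSubobject N' w := by
  have hcomp : (N.ofLE N' h).app Y ≫ N'.arrow.app Y = N.arrow.app Y := by
    rw [← NatTrans.comp_app, ofLE_arrow]
  refine le_of_forall_factors fun x hx => ?_
  obtain ⟨T', π, hπ, z, hz, hx⟩ := (leadingSubobject_factors_iff _ _ _).1 hx
  refine (leadingSubobject_factors_iff _ _ _).2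
    ⟨T', π, hπ, z ≫ (N.ofLE N' h).app Y, fun u hu => ?_, ?_⟩
  · simpa [reassoc_of% hcomp] using hz u hu
  · simpa [reassoc_of% hcomp] using hx

/-- A strictly monotone postcomposition sends leading terms to leading terms, with the same
coefficient. -/
theorem leadingSubobject_le_comp (N : Subobject (freeFunctor c M)) {Z : C} [LinearOrder (c ⟶ Z)]
    (f : Y ⟶ Z) (hf : StrictMono fun g : c ⟶ Y => g ≫ f) (w : c ⟶ Y) :
    leadingSubobject N w ≤ leadingSubobject N (w ≫ f) := by
  refine le_of_forall_factors fun x hx => ?_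
  obtain ⟨T', π, hπ, z, hz, hx⟩ := (leadingSubobject_factors_iff _ _ _).1 hx
  have hnat : ∀ k : c ⟶ Z, (z ≫ (N : C ⥤ A).map f) ≫ N.arrow.app Z ≫ coord k =
      (z ≫ N.arrow.app Y) ≫ (freeFunctor c M).map f ≫ coord k := fun k => by
    simp only [Category.assoc, NatTrans.naturality_assoc]
  refine (leadingSubobject_factors_iff _ _ _).2
    ⟨T', π, hπ, z ≫ (N : C ⥤ A).map f, fun u hu => ?_, ?_⟩
  · rw [hnat, comp_map_comp_coord f _ w u, if_neg hu.ne]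
    rintro g rfl -
    simpa using hz g (hf.lt_iff_lt.1 hu)
  · rw [hnat, comp_map_comp_coord f _ w (w ≫ f), if_pos rfl, hx, Category.assoc]
    intro g hg hgw
    exact absurd (hf.injective hg) hgw

/-- The division algorithm: cancel the leading coefficient, then descend in the finite order,
passing to an epimorphic cover each time. -/
theorem exists_lift_of_leadingSubobject_le {N N' : Subobject (freeFunctor c M)}
    (h : ∀ w : c ⟶ Y, leadingSubobject N' w ≤ leadingSubobject N w) (hle : N ≤ N') (w : c ⟶ Y)
    {T : A} (y : T ⟶ (N' : C ⥤ A).obj Y)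
    (hy : ∀ u, w < u → y ≫ N'.arrow.app Y ≫ coord u = 0) :
    ∃ (T' : A) (π : T' ⟶ T) (_ : Epi π) (z : T' ⟶ (N : C ⥤ A).obj Y),
      π ≫ y = z ≫ (N.ofLE N' hle).app Y := by
  have hcomp : (N.ofLE N' hle).app Y ≫ N'.arrow.app Y = N.arrow.app Y := by
    rw [← NatTrans.comp_app, ofLE_arrow]
  have := Fintype.ofFinite (c ⟶ Y)
  induction w using WellFoundedLT.induction generalizing T with
  | ind w ih =>
  have hfac : (leadingSubobject N' w).Factors (y ≫ N'.arrow.app Y ≫ coord w) :=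
    (leadingSubobject_factors_iff _ _ _).2 ⟨T, 𝟙 T, inferInstance, y, hy, by simp⟩
  obtain ⟨T₁, π₁, _, z₁, hz₁, hyz⟩ :=
    (leadingSubobject_factors_iff _ _ _).1 (factors_of_le _ (h w) hfac)
  let y' : T₁ ⟶ (N' : C ⥤ A).obj Y := π₁ ≫ y - z₁ ≫ (N.ofLE N' hle).app Y
  have hy' : ∀ u, w ≤ u → y' ≫ N'.arrow.app Y ≫ coord u = 0 := by
    intro u hu
    rcases hu.lt_or_eq with hu | rfl
    · simp [y', reassoc_of% hcomp, hy u hu, hz₁ u hu]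
    · simp [y', reassoc_of% hcomp, hyz]
  suffices ∃ (T' : A) (π : T' ⟶ T₁) (_ : Epi π) (z : T' ⟶ (N : C ⥤ A).obj Y),
      π ≫ y' = z ≫ (N.ofLE N' hle).app Y by
    obtain ⟨T₂, π₂, _, z₂, hz₂⟩ := this
    refine ⟨T₂, π₂ ≫ π₁, inferInstance, z₂ + π₂ ≫ z₁, ?_⟩
    rw [Preadditive.add_comp, ← hz₂]
    simp [y']
  by_cases hlt : ∃ u, u < w
  · obtain ⟨w', hw', hmax⟩ := Set.exists_max_image (Set.Iio w) id (Set.toFinite _) hlt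
    refine ih w' hw' y' fun u hu => hy' u ?_
    by_contra! huw
    exact (hmax u huw).not_gt hu
  · push Not at hlt
    refine ⟨T₁, 𝟙 _, inferInstance, 0, ?_⟩
    have : y' ≫ N'.arrow.app Y = 0 := eq_zero_of_coord _ fun k => by
      simpa using hy' k (hlt k)
    rw [Category.id_comp, zero_comp]
    rwa [← zero_comp (f := N'.arrow.app Y), cancel_mono] at this

theorem isIso_ofLE_app_of_leadingSubobject_le {N N' : Subobject (freeFunctor c M)}
    (h : ∀ w : c ⟶ Y, leadingSubobject N' w ≤ leadingSubobject N w) (hle : N ≤ N') :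
    IsIso ((N.ofLE N' hle).app Y) := by
  have : Epi ((N.ofLE N' hle).app Y) := by
    rw [epi_iff_surjective_up_to_refinements]
    intro T y
    rcases isEmpty_or_nonempty (c ⟶ Y) with hY | hY
    · refine ⟨T, 𝟙 _, inferInstance, 0, ?_⟩
      have : y ≫ N'.arrow.app Y = 0 := eq_zero_of_coord _ fun k => (hY.false k).elim
      rw [Category.id_comp, zero_comp]
      rwa [← zero_comp (f := N'.arrow.app Y), cancel_mono] at this
    · obtain ⟨w, -, hw⟩ := Set.exists_max_image (Set.univ : Set (c ⟶ Y)) id (Set.toFinite _)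
        Set.univ_nonempty
      exact exists_lift_of_leadingSubobject_le h hle w y
        fun u hu => ((hw u trivial).not_gt hu).elim
  exact isIso_of_mono_of_epi _

end Leading

/-- If the morphisms out of `c` into a family of objects meeting every isomorphism class carry
linear orders for which the relation of being a postcomposite by a strictly monotone
postcomposition is a well-quasi-order, then noetherian objects freely generate noetherian
functors at `c`. -/
theorem isNoetherianObject_freeFunctor {I : Type*} (Y : I → C)
    (hY : ∀ X : C, ∃ i, Nonempty (Y i ≅ X)) [∀ i, LinearOrder (c ⟶ Y i)]
    (hwqo : WellQuasiOrdered fun a b : Σ i, (c ⟶ Y i) =>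
      ∃ f : Y a.1 ⟶ Y b.1, (StrictMono fun g : c ⟶ Y a.1 => g ≫ f) ∧ a.2 ≫ f = b.2)
    [IsNoetherianObject M] : IsNoetherianObject (freeFunctor c M) := by
  dsimp only [IsNoetherianObject]
  rw [ObjectProperty.is_iff, isNoetherianObject]
  have : IsPreorder (Σ i, (c ⟶ Y i)) fun a b =>
      ∃ f : Y a.1 ⟶ Y b.1, (StrictMono fun g : c ⟶ Y a.1 => g ≫ f) ∧ a.2 ≫ f = b.2 :=
    { refl := fun a => ⟨𝟙 _, fun _ _ h => by simpa using h, by simp⟩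
      trans := by
        rintro a b d ⟨f, hf, hf'⟩ ⟨g, hg, hg'⟩
        exact ⟨f ≫ g, fun _ _ h => by simpa using hg (hf h), by rw [← Category.assoc, hf', hg']⟩ }
  refine wellFoundedGT_of_wellQuasiOrdered hwqo (fun N a => leadingSubobject N a.2)
    (fun N N' h a => leadingSubobject_mono h a.2) ?_ ?_
  · rintro N ⟨i, a⟩ ⟨j, b⟩ ⟨f, hf, hb⟩
    change Y i ⟶ Y j at f
    change a ≫ f = b at hb
    subst hb
    exact leadingSubobject_le_comp N f hf a
  · intro N N' h heq
    have hiso : IsIso (N.ofLE N' h) := by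
      rw [NatTrans.isIso_iff_isIso_app]
      intro X
      obtain ⟨i, ⟨e⟩⟩ := hY X
      have := isIso_ofLE_app_of_leadingSubobject_le (Y := Y i)
        (fun w => (congrFun heq ⟨i, w⟩).ge) h
      rw [← NatTrans.isIso_app_iff_of_iso _ e]
      exact this
    exact eq_of_comm (asIso (N.ofLE N' h)) (by simp)

end FreeFunctor

/-! ### Generators of the functor category -/

section FunctorCategory

open Limits Opposite

/-- A transformation is determined by its components at representatives of the isomorphism classes,
so `C` itself may be large. -/
theorem locallySmall_functor {C : Type*} [Category* C] {A : Type*} [Category* A]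
    [LocallySmall.{w} A] {I : Type*} [Small.{w} I] (Y : I → C)
    (hY : ∀ X : C, ∃ i, Nonempty (Y i ≅ X)) : LocallySmall.{w} (C ⥤ A) where
  hom_small F G := by
    refine small_of_injective (β := ∀ i, F.obj (Y i) ⟶ G.obj (Y i))
      (f := fun α i => α.app (Y i)) fun α β h => ?_
    ext X
    obtain ⟨i, ⟨e⟩⟩ := hY X
    rw [← cancel_epi (F.map e.hom), α.naturality, β.naturality]
    exact congrArg (· ≫ G.map e.hom) (congrFun h i)

theorem isLocallyNoetherianGrothendieck_functor {C : Type*} [Category* C]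
    [∀ X Y : C, Finite (X ⟶ Y)] {A : Type*} [Category* A] [Abelian A]
    [hA : IsLocallyNoetherianGrothendieck.{w} A]
    {I : Type*} [Small.{w} I] (Y : I → C) (hY : ∀ X : C, ∃ i, Nonempty (Y i ≅ X))
    (hnoeth : ∀ i (M : A) [IsNoetherianObject M], IsNoetherianObject (freeFunctor (Y i) M)) :
    IsLocallyNoetherianGrothendieck.{w} (C ⥤ A) := by
  have := hA.isGrothendieckAbelian
  obtain ⟨P, hPsmall, hPnoeth, hP⟩ := hA.exists_generators
  let G : I × Subtype P → C ⥤ A := fun x => freeFunctor (Y x.1) x.2.1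
  have hsep : (ObjectProperty.ofObj G).IsSeparating := by
    intro F F' α β h
    ext X
    obtain ⟨i, ⟨e⟩⟩ := hY X
    rw [← cancel_epi (F.map e.hom), α.naturality, β.naturality]
    congr 1
    refine hP _ _ fun M hM x => ?_
    -- Maps from a free functor at `Y i` are generalized elements of the value there, which the
    -- generators of `A` separate.
    let adj := evaluationAdjunctionRight A (Y i)
    have := h (G (i, ⟨M, hM⟩)) ⟨_⟩ ((adj.homEquiv _ _).symm x)
    have := congrArg (adj.homEquiv _ _) this
    rwa [adj.homEquiv_naturality_right, adj.homEquiv_naturality_right,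
      Equiv.apply_symm_apply] at this
  refine ⟨?_, .ofObj G, inferInstance, ?_, hsep⟩
  · have := locallySmall_functor.{w} (A := A) Y hY
    refine { hasSeparator := ?_, ab5OfSize := ⟨fun J _ _ => inferInstance⟩ }
    let f : Shrink.{w} (I × Subtype P) → C ⥤ A := fun x => G ((equivShrink _).symm x)
    refine ⟨∐ f, ObjectProperty.IsSeparating.isSeparator_coproduct (hsep.of_le ?_)⟩
    rintro _ ⟨x⟩
    simpa [f] using ObjectProperty.ofObj_apply f (equivShrink _ x)
  · rintro _ ⟨x⟩
    have := hPnoeth _ x.2.2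
    exact hnoeth x.1 x.2.1

end FunctorCategory

/-! ### Finite sets -/

section FiniteSets

open Opposite

/-- The words in `X` of length `n`, as morphisms of finite sets. -/
def wordEquiv (X : FintypeCat.{t}) (n : ℕ) :
    (op X ⟶ op (FintypeCat.of (ULift.{t} (Fin n)))) ≃ (Fin n → X) where
  toFun g i := g.unop ⟨i⟩
  invFun u := (FintypeCat.homMk fun i : ULift.{t} (Fin n) => u i.down).op
  left_inv _ := rfl
  right_inv _ := rfl

theorem exists_iso_op_ulift_fin (X : FintypeCat.{t}ᵒᵖ) :
    ∃ n, Nonempty (op (FintypeCat.of (ULift.{t} (Fin n))) ≅ X) := by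
  obtain ⟨n, ⟨e⟩⟩ := Finite.exists_equiv_fin X.unop
  exact ⟨n, ⟨(FintypeCat.equivEquivIso (e.trans Equiv.ulift.symm)).op⟩⟩

instance finite_op_hom (X Y : FintypeCat.{t}ᵒᵖ) : Finite (X ⟶ Y) :=
  Finite.of_injective (β := Y.unop → X.unop) (fun g => g.unop)
    fun _ _ h => Quiver.Hom.unop_inj (FintypeCat.hom_ext _ _ (congrFun h))

theorem isNoetherianObject_freeFunctor_fintypeCat {A : Type*} [Category* A] [Abelian A]
    (X : FintypeCat.{t}) (M : A) [IsNoetherianObject M] :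
    IsNoetherianObject (freeFunctor (op X) M) := by
  obtain ⟨k, ⟨e⟩⟩ := Finite.exists_equiv_fin X
  -- Any linear order on the alphabet serves.
  let lin : LinearOrder X := LinearOrder.lift' e e.injective
  let ord (n : ℕ) : LinearOrder (op X ⟶ op (FintypeCat.of (ULift.{t} (Fin n)))) :=
    LinearOrder.lift' (fun g => toLex (wordEquiv X n g)) fun _ _ h => (wordEquiv X n).injective h
  refine isNoetherianObject_freeFunctor (fun n => op (FintypeCat.of (ULift.{t} (Fin n))))
    exists_iso_op_ulift_fin fun s => ?_
  obtain ⟨m, n, hmn, f, hf, hfs⟩ := wellQuasiOrdered_orderedSurjection X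
    fun n => ⟨(s n).1, wordEquiv X _ (s n).2⟩
  let φ (i : ULift.{t} (Fin (s n).1)) : ULift.{t} (Fin (s m).1) := ⟨f i.down⟩
  refine ⟨m, n, hmn, (FintypeCat.homMk φ).op, fun u v h => ?_, ?_⟩
  · exact hf.toLex_comp_lt h
  · exact (wordEquiv X _).injective hfs

end FiniteSets

/-- `FintypeCat` is the category of all finite sets (in any universe) and all maps. -/
theorem mainTheorem2 (A : Type u) [Category.{v} A] [Abelian A]
    [IsLocallyNoetherianGrothendieck.{w} A] :
    IsLocallyNoetherianGrothendieck.{w} (FintypeCat.{t}ᵒᵖ ⥤ A) :=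
  isLocallyNoetherianGrothendieck_functor _ exists_iso_op_ulift_fin
    fun n M _ => isNoetherianObject_freeFunctor_fintypeCat (FintypeCat.of (ULift.{t} (Fin n))) M
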